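/- Let $n\ge 1$, $s\in(0,1)$, and let $\Omega\subset\mathbb{R}^n$ be a nonempty bounded open set with $C^{1,1}$ boundary (connected or not). Let $$C_{n,s}=s\,4^s\frac{\Gamma(s+n/2)}{\pi^{n/2}\,\Gamma(1-s)},\qquad \mathcal{E}(u,v)=\frac{C_{n,s}}{2}\int_{\mathbb{R}^n}\int_{\mathbb{R}^n}\frac{(u(x)-u(y))(v(x)-v(y))}{|x-y|^{n+2s}}\,dx\,dy,$$ let $H^s(\mathbb{R}^n)$ be the space of real-valued $u\in L^2(\mathbb{R}^n)$ with $\frac{u(x)-u(y)}{|x-y|^{n/2+s}}\in L^2(\mathbb{R}^n\times\mathbb{R}^n)$, and let $\mathcal{H}^s_0(\Omega)$ be the space of $u\in H^s(\mathbb{R}^n)$ with $u=0$ almost everywhere in $\mathbb{R}^n\setminus\Omega$. For a continuous $V:\mathbb{R}^n\to\mathbb{R}$, a number $\lambda\in\mathbb{R}$ is called a Dirichlet eigenvalue of $(-\Delta)^s+V$ on $\Omega$ if there is $\varphi\in\mathcal{H}^s_0(\Omega)$, $\varphi\neq 0$, such that $$\mathcal{E}(\varphi,v)+\int_{\mathbb{R}^n}V\varphi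 v\,dx=\lambda\int_{\mathbb{R}^n}\varphi v\,dx\qquad\text{for all } v\in\mathcal{H}^s_0(\Omega),$$ and it is called simple if the vector space of all $\varphi\in\mathcal{H}^s_0(\Omega)$ with this property is one-dimensional. There is a $\delta>0$, depending only on $n$, $s$ and $\Omega$, such that the following holds. Let $a:\mathbb{R}^n\to\mathbb{R}$ be continuous with either $\min_{\overline\Omega}a>0$ or $\sup_{\Omega}|a|\le\delta$. Then for every $\varepsilon>0$ there is a bounded continuous function $b:\mathbb{R}^n\to\mathbb{R}$ with $\sup_{\mathbb{R}^n}|b|<\varepsilon$ such that every Dirichlet eigenvalue of $(-\Delta)^s+(a+b)$ on $\Omega$ is simple. -/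

import Mathlib

open MeasureTheory Set

open scoped InnerProductSpace

noncomputable section

namespace FracLaplacian

/-- Euclidean space `ℝⁿ`. -/
abbrev Space (n : ℕ) : Type := EuclideanSpace ℝ (Fin n)

/-- `L²(ℝⁿ)`: real square-integrable functions modulo almost everywhere equality. -/
abbrev L2 (n : ℕ) : Type := Lp ℝ 2 (volume : Measure (Space n))

/-- Nonempty bounded open subsets of `ℝⁿ` with `C^{1,1}` boundary: near each boundary point `x₀`,
for some unit vector `ν`, the set is the region lying (in the direction `ν`) above the graph of a
function on the hyperplane `ν^⊥` that is differentiable with Lipschitz derivative.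
Connectedness is not required. -/
structure IsBoundedC11 {n : ℕ} (Ω : Set (Space n)) : Prop where
  nonempty : Ω.Nonempty
  isOpen : IsOpen Ω
  isBounded : Bornology.IsBounded Ω
  boundary : ∀ x₀ ∈ frontier Ω, ∃ r > 0, ∃ ν : Space n, ‖ν‖ = 1 ∧
    ∃ γ : (ℝ ∙ ν)ᗮ → ℝ, Differentiable ℝ γ ∧ (∃ K, LipschitzWith K (fderiv ℝ γ)) ∧
      ∀ x ∈ Metric.ball x₀ r, x ∈ Ω ↔ γ ((ℝ ∙ ν)ᗮ.orthogonalProjectionOnto x) < ⟪ν, x⟫_ℝ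

/-- The quotient `(u(x) - u(y)) / |x - y|^{n/2 + s}` on `ℝⁿ × ℝⁿ`. -/
def gagliardoQuotient {n : ℕ} (s : ℝ) (u : Space n → ℝ) (p : Space n × Space n) : ℝ :=
  (u p.1 - u p.2) / ‖p.1 - p.2‖ ^ ((n : ℝ) / 2 + s)

lemma ae_prod_of_ae {n : ℕ} {P : Space n → Prop} (h : ∀ᵐ x, P x) :
    ∀ᵐ p : Space n × Space n, P p.1 ∧ P p.2 :=
  (Measure.quasiMeasurePreserving_fst.ae h).and (Measure.quasiMeasurePreserving_snd.ae h)

/-- `H^s(ℝⁿ)`, as a subspace of `L²(ℝⁿ)`. -/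
def Hs (n : ℕ) (s : ℝ) : Submodule ℝ (L2 n) where
  carrier := {u | MemLp (gagliardoQuotient s u) 2 (volume : Measure (Space n × Space n))}
  zero_mem' := by
    refine (MemLp.zero (ε := ℝ)).ae_eq ?_
    filter_upwards [ae_prod_of_ae (Lp.coeFn_zero ℝ 2 (volume : Measure (Space n)))] with p hp
    have h1 := hp.1
    have h2 := hp.2
    simp only [Pi.zero_apply] at h1 h2
    simp only [gagliardoQuotient, h1, h2, Pi.zero_apply, sub_zero, zero_div]
  add_mem' := by
    intro u v hu hv
    refine (MemLp.add hu hv).ae_eq ?_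
    filter_upwards [ae_prod_of_ae (Lp.coeFn_add u v)] with p hp
    simp only [gagliardoQuotient, hp.1, hp.2, Pi.add_apply]
    ring
  smul_mem' := by
    intro c u hu
    refine (MemLp.const_smul hu c).ae_eq ?_
    filter_upwards [ae_prod_of_ae (Lp.coeFn_smul c u)] with p hp
    simp only [gagliardoQuotient, hp.1, hp.2, Pi.smul_apply, smul_eq_mul]
    ring

/-- `𝓗₀ˢ(Ω)`: the functions in `H^s(ℝⁿ)` that vanish (almost everywhere) outside `Ω`. -/
def Hs0 {n : ℕ} (s : ℝ) (Ω : Set (Space n)) : Submodule ℝ (L2 n) where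
  carrier := {u | u ∈ Hs n s ∧ ∀ᵐ x, x ∉ Ω → u x = 0}
  zero_mem' := by
    refine ⟨zero_mem _, ?_⟩
    filter_upwards [Lp.coeFn_zero ℝ 2 (volume : Measure (Space n))] with x hx _
    rw [hx, Pi.zero_apply]
  add_mem' := by
    intro u v hu hv
    refine ⟨add_mem hu.1 hv.1, ?_⟩
    filter_upwards [Lp.coeFn_add u v, hu.2, hv.2] with x hx h1 h2 hxΩ
    rw [hx, Pi.add_apply, h1 hxΩ, h2 hxΩ, add_zero]
  smul_mem' := by
    intro c u hu
    refine ⟨Submodule.smul_mem _ c hu.1, ?_⟩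
    filter_upwards [Lp.coeFn_smul c u, hu.2] with x hx h1 hxΩ
    rw [hx, Pi.smul_apply, h1 hxΩ, smul_zero]

/-- The normalization constant `C_{n,s} = s 4^s Γ(s + n/2) / (π^{n/2} Γ(1 - s))`. -/
def normConst (n : ℕ) (s : ℝ) : ℝ :=
  s * 4 ^ s * Real.Gamma (s + (n : ℝ) / 2) / (Real.pi ^ ((n : ℝ) / 2) * Real.Gamma (1 - s))

/-- The bilinear form of `(-Δ)^s`. For `u, v ∈ H^s(ℝⁿ)` the integrand is integrable. -/
def energy {n : ℕ} (s : ℝ) (u v : L2 n) : ℝ :=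
  normConst n s / 2 * ∫ p : Space n × Space n,
    (u p.1 - u p.2) * (v p.1 - v p.2) / ‖p.1 - p.2‖ ^ ((n : ℝ) + 2 * s)

/-- `φ` is a weak solution of `(-Δ)^s φ + V φ = lam φ` in `Ω`, `φ = 0` in `ℝⁿ \ Ω`. -/
def IsWeakSolution {n : ℕ} (s : ℝ) (Ω : Set (Space n)) (V : Space n → ℝ) (lam : ℝ)
    (φ : L2 n) : Prop :=
  φ ∈ Hs0 s Ω ∧
    ∀ v ∈ Hs0 s Ω, energy s φ v + ∫ x, V x * φ x * v x = lam * ∫ x, φ x * v x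

/-- `lam` is a Dirichlet eigenvalue of `(-Δ)^s + V` on `Ω`. -/
def IsEigenvalue {n : ℕ} (s : ℝ) (Ω : Set (Space n)) (V : Space n → ℝ) (lam : ℝ) : Prop :=
  ∃ φ : L2 n, φ ≠ 0 ∧ IsWeakSolution s Ω V lam φ

/-- `lam` is a simple Dirichlet eigenvalue of `(-Δ)^s + V` on `Ω`: the space of weak solutions is
spanned by one nonzero function. -/
def IsSimpleEigenvalue {n : ℕ} (s : ℝ) (Ω : Set (Space n)) (V : Space n → ℝ) (lam : ℝ) : Prop :=
  ∃ φ : L2 n, φ ≠ 0 ∧ ∀ ψ : L2 n, IsWeakSolution s Ω V lam ψ ↔ ∃ c : ℝ, ψ = c • φ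

end FracLaplacian

end

/-!
Generic simplicity of the Dirichlet eigenvalues of `(-Δ)^s + V` under small changes of `V`.

Write `H` for `𝓗₀ˢ(Ω)` with the inner product `⟨u, v⟩ + 𝓔(u, v)` and `J : H → L²` for the inclusion.
It is compact, because on a grid of cubes of side `h` the average of `u` over each cube approximates
`u` in `L²` up to `O(h^s) ‖u‖_H`, and on functions supported in a bounded set this averaging has
finite rank (`isCompactOperator_embedding`). By Riesz representation, `φ` solves the weak
eigenvalue equation with potential `B` and eigenvalue `lam` exactly when
`φ + J J† (B - (lam + 1)) φ = 0` in `L²` (`isWeakSolution_iff`). What remains is operator theory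
for a compact `J` and bounded symmetric `B`, where such `φ` form `formEigenspace J B (lam + 1)`.

For `B + ‖B‖` the form is coercive whatever the sign of the potential, so the shifted operator has a
compact symmetric inverse. The spectral theorem for this inverse gives a quantitative gap estimate
(`gap_mul_norm_le`): away from the eigenspace of `lam`, the operator minus `lam` is bounded below by
the distance from `lam` to the other eigenvalues. Hence eigenvalues move by at most the norm of a
perturbation of `B` (`exists_eigenvalue_near`), and they are isolated (`exists_isolated`).

For rational `p < q`, the potentials `b` for which there are two distinct eigenvalues in `(p, q)`
therefore form an open set `W p q`. By Baire's theorem the potentials lying on none of the nowhere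
dense frontiers `∂(W p q)` are dense. Let `b` be one of them and `lam` an eigenvalue, alone in
`(p, q)`. Then `b` is outside `W p q`, hence outside its closure, so `lam` does not split under
any small perturbation. First-order perturbation theory (`inner_eq_of_unique_eigenvalue`) forces
`β ↦ ⟨β φ, ψ⟩` to vanish and `⟨β φ, φ⟩ = ⟨β ψ, ψ⟩`, for all directions `β` and any orthonormal
`φ, ψ` in the eigenspace. For multiplication operators this says `φ ψ = 0` and `φ² = ψ²` almost
everywhere, so `φ = 0` (`eq_zero_of_forall_bcf`), which is absurd: `lam` is simple.
-/

noncomputable section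

namespace FracLaplacian

/-! ### Eigenvalues of a form with compact inclusion -/

section Abstract

variable {X H : Type*} [NormedAddCommGroup X] [InnerProductSpace ℝ X] [CompleteSpace X]
  [NormedAddCommGroup H] [InnerProductSpace ℝ H] [CompleteSpace H]

/-- An inequality between the coefficients along the eigenvectors of a compact symmetric operator
passes to the norms, by Parseval's identity for the Hilbert sum of the eigenspaces. -/
lemma norm_le_of_forall_eigenvector {T : X →L[ℝ] X} (hT : IsCompactOperator T)
    (hTs : (T : X →ₗ[ℝ] X).IsSymmetric) {x y : X} {δ : ℝ} (hδ : 0 ≤ δ)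
    (h : ∀ (τ : ℝ) (e : X), T e = τ • e → δ * |⟪x, e⟫_ℝ| ≤ |⟪y, e⟫_ℝ|) :
    δ * ‖x‖ ≤ ‖y‖ := by
  have hcl : ∀ τ : ℝ, IsClosed (Module.End.eigenspace (T : X →ₗ[ℝ] X) τ : Set X) := by
    intro τ
    have : (Module.End.eigenspace (T : X →ₗ[ℝ] X) τ : Set X) = {v | T v = τ • v} := by
      ext v; simp
    rw [this]
    exact isClosed_eq T.continuous (continuous_const_smul τ)
  have : ∀ τ : ℝ, CompleteSpace (Module.End.eigenspace (T : X →ₗ[ℝ] X) τ) :=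
    fun τ => (hcl τ).completeSpace_coe
  have hsum := IsHilbertSum.mkInternal (𝕜 := ℝ) (fun τ : ℝ =>
      Module.End.eigenspace (T : X →ₗ[ℝ] X) τ) hTs.orthogonalFamily_eigenspaces (by
    have := ContinuousLinearMap.orthogonalComplement_iSup_eigenspaces_eq_bot hT hTs
    rw [top_le_iff, Submodule.topologicalClosure_eq_top_iff]
    exact this)
  set L := hsum.linearIsometryEquiv with hL
  have hco : ∀ (z : X) (τ : ℝ) (v : Module.End.eigenspace (T : X →ₗ[ℝ] X) τ),
      ⟪z, (v : X)⟫_ℝ = ⟪L z τ, v⟫_ℝ := by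
    classical
    intro z τ v
    have h1 : L.symm (lp.single 2 τ v) = (v : X) := by
      rw [hL, hsum.linearIsometryEquiv_symm_apply_single]; rfl
    rw [← h1, ← L.inner_map_map, L.apply_symm_apply, lp.inner_single_right]
  have hsq : ∀ z : X, HasSum (fun τ => ‖L z τ‖ ^ 2) (‖z‖ ^ 2) := by
    intro z
    have := lp.hasSum_norm (p := 2) (by norm_num) (L z)
    simpa using this
  have hpt : ∀ τ, δ ^ 2 * ‖L x τ‖ ^ 2 ≤ ‖L y τ‖ ^ 2 := by
    intro τ
    have h1 := h τ (L x τ : X) (Module.End.mem_eigenspace_iff.mp (L x τ).2)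
    rw [hco, hco, real_inner_self_eq_norm_sq, abs_of_nonneg (by positivity)] at h1
    have h2 := h1.trans (abs_real_inner_le_norm _ _)
    rcases (norm_nonneg (L x τ)).eq_or_lt with h0 | h0
    · rw [← h0]; simp
    · have h3 : δ * ‖L x τ‖ ≤ ‖L y τ‖ := by
        by_contra! h4
        nlinarith
      rw [← mul_pow]
      gcongr
  have := hasSum_le hpt ((hsq x).mul_left (δ ^ 2)) (hsq y)
  rw [← mul_pow] at this
  exact le_of_sq_le_sq this (norm_nonneg _)

/-- The eigenspace for the eigenvalue `lam` of the operator `A + B`, where `A` is the unbounded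
operator on `X` associated with the form `⟪U, W⟫` on the form domain `H`, included in `X` by `J`.
As `J J†` plays the role of `A⁻¹`, the equation `(A + B) φ = lam φ` is encoded as
`φ + J J† (B - lam) φ = 0`. The range of `J` need not be dense. -/
def formEigenspace (J : H →L[ℝ] X) (B : X →L[ℝ] X) (lam : ℝ) : Submodule ℝ X :=
  LinearMap.ker ((1 + (J ∘L J.adjoint) ∘L (B - lam • 1) : X →L[ℝ] X) : X →ₗ[ℝ] X)

lemma mem_formEigenspace {J : H →L[ℝ] X} {B : X →L[ℝ] X} {lam : ℝ} {φ : X} :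
    φ ∈ formEigenspace J B lam ↔ φ + J (J.adjoint (B φ - lam • φ)) = 0 := by
  simp [formEigenspace]

lemma isClosed_formEigenspace (J : H →L[ℝ] X) (B : X →L[ℝ] X) (lam : ℝ) :
    IsClosed (formEigenspace J B lam : Set X) :=
  ContinuousLinearMap.isClosed_ker _

instance (J : H →L[ℝ] X) (B : X →L[ℝ] X) (lam : ℝ) : CompleteSpace (formEigenspace J B lam) :=
  (isClosed_formEigenspace J B lam).completeSpace_coe

/-- The form `⟪U, W⟫ + ⟪(B + ‖B‖) J U, J W⟫` is coercive, so the operator representing it on `H` is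
invertible, and its inverse is symmetric. -/
lemma exists_symmetric_inverse {J : H →L[ℝ] X} {B : X →L[ℝ] X} (hB : (B : X →ₗ[ℝ] X).IsSymmetric) :
    ∃ S : H ≃L[ℝ] H, (∀ U, S U = U + J.adjoint (B (J U) + ‖B‖ • J U)) ∧
      ∀ U W, ⟪S.symm U, W⟫_ℝ = ⟪U, S.symm W⟫_ℝ := by
  let S : H →L[ℝ] H := 1 + J.adjoint ∘L (B + ‖B‖ • 1) ∘L J
  have hS : ∀ U, S U = U + J.adjoint (B (J U) + ‖B‖ • J U) := by intro U; simp [S]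
  have hin : ∀ U W, ⟪S U, W⟫_ℝ = ⟪U, W⟫_ℝ + ⟪B (J U), J W⟫_ℝ + ‖B‖ * ⟪J U, J W⟫_ℝ := by
    intro U W
    rw [hS, inner_add_left, ContinuousLinearMap.adjoint_inner_left, inner_add_left,
      real_inner_smul_left]
    ring
  have hco : IsCoercive ((innerSL ℝ) ∘L S : H →L[ℝ] H →L[ℝ] ℝ) := by
    refine ⟨1, one_pos, fun U => ?_⟩
    change 1 * ‖U‖ * ‖U‖ ≤ ⟪S U, U⟫_ℝ
    rw [hin, real_inner_self_eq_norm_sq, real_inner_self_eq_norm_sq]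
    have h1 := abs_le.mp ((abs_real_inner_le_norm (B (J U)) (J U)).trans
      (mul_le_mul_of_nonneg_right (B.le_opNorm _) (norm_nonneg _)))
    nlinarith [h1.1]
  have hE : ∀ U, hco.continuousLinearEquivOfBilin U = S U := by
    intro U
    refine ext_inner_right ℝ fun W => ?_
    rw [hco.continuousLinearEquivOfBilin_apply]
    rfl
  refine ⟨hco.continuousLinearEquivOfBilin, fun U => (hE U).trans (hS U), fun U W => ?_⟩
  have hsym : ∀ U W, ⟪S U, W⟫_ℝ = ⟪U, S W⟫_ℝ := by
    intro U W
    rw [real_inner_comm (S W), hin, hin]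
    have := hB (J U) (J W)
    simp only [ContinuousLinearMap.coe_coe] at this
    rw [this, real_inner_comm (B (J W)), real_inner_comm W U, real_inner_comm (J W) (J U)]
  set R := hco.continuousLinearEquivOfBilin
  have := hsym (R.symm U) (R.symm W)
  rw [← hE, ← hE, R.apply_symm_apply, R.apply_symm_apply] at this
  exact this.symm

/-- Gap estimate. In the notation of `formEigenspace`, the hypothesis `hf` says
`(A + B - lam) φ = f`. If there is no eigenvalue other than `lam` within distance `δ` of `lam` and
`φ` is orthogonal to the eigenspace of `lam`, then `δ ‖φ‖ ≤ ‖f‖`. -/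
lemma gap_mul_norm_le {J : H →L[ℝ] X} (hJ : IsCompactOperator J) {B : X →L[ℝ] X}
    (hB : (B : X →ₗ[ℝ] X).IsSymmetric) {lam δ : ℝ} (hδ : 0 ≤ δ)
    (hgap : ∀ μ, μ ≠ lam → |μ - lam| < δ → formEigenspace J B μ = ⊥)
    {φ f : X} (hφ : φ ∈ (formEigenspace J B lam)ᗮ)
    (hf : φ + J (J.adjoint (B φ - lam • φ)) = J (J.adjoint f)) :
    δ * ‖φ‖ ≤ ‖f‖ := by
  obtain ⟨S, hS, hSs⟩ := exists_symmetric_inverse (J := J) hB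
  set c := ‖B‖
  -- `T` is the inverse of `A + B + ‖B‖`: a compact symmetric operator whose eigenvectors for `τ ≠ 0`
  -- are the eigenvectors of `A + B` for `τ⁻¹ - ‖B‖`.
  let T : X →L[ℝ] X := J ∘L (S.symm : H →L[ℝ] H) ∘L J.adjoint
  have hTa : ∀ x, T x = J (S.symm (J.adjoint x)) := fun x => rfl
  have hT : IsCompactOperator T :=
    hJ.comp_clm ((S.symm : H →L[ℝ] H) ∘L J.adjoint)
  have hTs : ∀ x y, ⟪T x, y⟫_ℝ = ⟪x, T y⟫_ℝ := by
    intro x y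
    rw [hTa, hTa, ← ContinuousLinearMap.adjoint_inner_right, hSs,
      ContinuousLinearMap.adjoint_inner_left]
  have hTg : T (f + (lam + c) • φ) = φ := by
    set U := J.adjoint (f - (B φ - lam • φ)) with hU
    have hJU : J U = φ := by
      rw [hU, map_sub, map_sub, ← hf]; abel
    have : S U = J.adjoint (f + (lam + c) • φ) := by
      rw [hS, hJU, hU, ← map_add]; congr 1; module
    rw [hTa, ← this, S.symm_apply_apply, hJU]
  have hTe : ∀ τ e, τ ≠ 0 → T e = τ • e → e ∈ formEigenspace J B (τ⁻¹ - c) := by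
    intro τ e hτ he
    rw [mem_formEigenspace]
    set U := S.symm (J.adjoint e) with hU
    have hJU : J U = τ • e := he
    have h1 : S U = J.adjoint e := by rw [hU, S.apply_symm_apply]
    rw [hS, hJU] at h1
    have h2 := congrArg J h1
    rw [map_add, hJU] at h2
    have h3 : B e - (τ⁻¹ - c) • e = τ⁻¹ • (B (τ • e) + c • τ • e) - τ⁻¹ • e := by
      rw [map_smul]
      match_scalars <;> field_simp
      ring
    have h4 : J (J.adjoint (B e - (τ⁻¹ - c) • e)) =
        τ⁻¹ • J (J.adjoint (B (τ • e) + c • τ • e)) - τ⁻¹ • J (J.adjoint e) := by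
      rw [h3, map_sub, map_sub, map_smul J.adjoint, map_smul J, map_smul J.adjoint, map_smul J]
    rw [h4, ← h2, smul_add, inv_smul_smul₀ hτ]
    abel
  refine norm_le_of_forall_eigenvector hT hTs hδ fun τ e he => ?_
  set g := f + (lam + c) • φ with hg
  have hφe : ⟪φ, e⟫_ℝ = τ * ⟪g, e⟫_ℝ := by
    rw [← hTg, hTs, he, real_inner_smul_right]
  rcases eq_or_ne ⟪φ, e⟫_ℝ 0 with h0 | h0
  · rw [h0]; simp
  have hτ : τ ≠ 0 := by rintro rfl; simp at hφe; exact h0 hφe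
  have hmem := hTe τ e hτ he
  have hne : τ⁻¹ - c ≠ lam := by
    intro hl
    rw [hl] at hmem
    exact h0 (by rw [real_inner_comm]; exact hφ e hmem)
  have hge : δ ≤ |τ⁻¹ - c - lam| := by
    by_contra! hlt
    have := hgap _ hne hlt
    rw [this, Submodule.mem_bot] at hmem
    rw [hmem, inner_zero_right] at h0
    exact h0 rfl
  have hfe : ⟪f, e⟫_ℝ = (τ⁻¹ - c - lam) * ⟪φ, e⟫_ℝ := by
    have h1 : ⟪g, e⟫_ℝ = ⟪f, e⟫_ℝ + (lam + c) * ⟪φ, e⟫_ℝ := by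
      rw [hg, inner_add_left, real_inner_smul_left]
    have h2 : ⟪g, e⟫_ℝ = τ⁻¹ * ⟪φ, e⟫_ℝ := by rw [hφe, inv_mul_cancel_left₀ hτ]
    linarith
  rw [hfe, abs_mul]
  gcongr

/-- A perturbation of `B` of norm less than `η` moves each eigenvalue by less than `η`. -/
lemma exists_eigenvalue_near {J : H →L[ℝ] X} (hJ : IsCompactOperator J) {B B' : X →L[ℝ] X}
    (hB' : (B' : X →ₗ[ℝ] X).IsSymmetric) {lam η : ℝ} (hη : ‖B' - B‖ < η)
    (h : formEigenspace J B lam ≠ ⊥) :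
    ∃ μ, |μ - lam| < η ∧ formEigenspace J B' μ ≠ ⊥ := by
  by_contra! hno
  have hη0 : 0 < η := (norm_nonneg _).trans_lt hη
  obtain ⟨φ, hφ, hφ0⟩ := Submodule.exists_mem_ne_zero_of_ne_bot h
  rw [mem_formEigenspace] at hφ
  have hbot : formEigenspace J B' lam = ⊥ := hno lam (by simpa using hη0)
  have := gap_mul_norm_le hJ hB' hη0.le (fun μ _ hμ => hno μ hμ) (φ := φ) (f := (B' - B) φ)
    (by rw [hbot]; simp) (by
      have : B' φ - lam • φ = (B φ - lam • φ) + (B' - B) φ := by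
        rw [sub_apply]; abel
      rw [this, map_add, map_add, ← add_assoc, hφ, zero_add])
  have h2 := this.trans ((B' - B).le_opNorm φ)
  have h3 : 0 < ‖φ‖ := norm_pos_iff.mpr hφ0
  nlinarith

/-- The range of `A + B - lam` is orthogonal to the eigenspace of `lam`. -/
lemma inner_residual_eq_zero {J : H →L[ℝ] X} {B : X →L[ℝ] X}
    (hB : (B : X →ₗ[ℝ] X).IsSymmetric) {lam : ℝ} {φ f ψ : X}
    (hf : φ + J (J.adjoint (B φ - lam • φ)) = J (J.adjoint f))
    (hψ : ψ ∈ formEigenspace J B lam) : ⟪f, ψ⟫_ℝ = 0 := by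
  rw [mem_formEigenspace] at hψ
  have hK : ∀ x y, ⟪J (J.adjoint x), y⟫_ℝ = ⟪x, J (J.adjoint y)⟫_ℝ := by
    intro x y
    rw [← ContinuousLinearMap.adjoint_inner_right, ContinuousLinearMap.adjoint_inner_left]
  have hs : ⟪φ, B ψ - lam • ψ⟫_ℝ = ⟪B φ - lam • φ, ψ⟫_ℝ := by
    have := hB φ ψ
    simp only [ContinuousLinearMap.coe_coe] at this
    rw [inner_sub_right, inner_sub_left, this, real_inner_smul_left, real_inner_smul_right]
  have hψ' : J (J.adjoint (B ψ - lam • ψ)) = -ψ := by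
    rw [eq_neg_iff_add_eq_zero, add_comm]; exact hψ
  have h1 := hK f (B ψ - lam • ψ)
  rw [← hf, inner_add_left, hs, hK, hψ', inner_neg_right, inner_neg_right] at h1
  linarith

/-- Every real number is isolated from the eigenvalues different from it: normalized eigenvectors
for eigenvalues converging to `lam` would accumulate, by compactness of `J J†`, at a unit eigenvector
for `lam` to which they are all orthogonal. -/
lemma exists_isolated {J : H →L[ℝ] X} (hJ : IsCompactOperator J) {B : X →L[ℝ] X}
    (hB : (B : X →ₗ[ℝ] X).IsSymmetric) (lam : ℝ) :
    ∃ δ > 0, ∀ μ, μ ≠ lam → |μ - lam| < δ → formEigenspace J B μ = ⊥ := by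
  by_contra! hno
  have hex : ∀ k : ℕ, ∃ μ φ, μ ≠ lam ∧ |μ - lam| < 1 / ((k : ℝ) + 1) ∧
      φ ∈ formEigenspace J B μ ∧ ‖φ‖ = 1 := by
    intro k
    obtain ⟨μ, h1, h2, h3⟩ := hno (1 / ((k : ℝ) + 1)) (by positivity)
    obtain ⟨φ, hφ, hφ0⟩ := Submodule.exists_mem_ne_zero_of_ne_bot h3
    exact ⟨μ, ‖φ‖⁻¹ • φ, h1, h2, Submodule.smul_mem _ _ hφ, norm_smul_inv_norm hφ0⟩
  choose μ φ hne hμ hφ hφ1 using hex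
  have hμl : Filter.Tendsto μ Filter.atTop (nhds lam) := by
    rw [tendsto_iff_norm_sub_tendsto_zero]
    exact squeeze_zero (fun _ => norm_nonneg _) (fun k => (hμ k).le)
      tendsto_one_div_add_atTop_nhds_zero_nat
  let K : X →L[ℝ] X := J ∘L J.adjoint
  have hK : IsCompactOperator K := hJ.comp_clm _
  have hcpt := hK.isCompact_closure_image_closedBall (𝕜₁ := ℝ) (‖B‖ + (|lam| + 1))
  have hφK : ∀ k, φ k = -K (B (φ k) - μ k • φ k) := by
    intro k
    exact eq_neg_of_add_eq_zero_left (mem_formEigenspace.mp (hφ k))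
  have hmem : ∀ k, φ k ∈ closure (K '' Metric.closedBall 0 (‖B‖ + (|lam| + 1))) := by
    intro k
    refine subset_closure ⟨-(B (φ k) - μ k • φ k), ?_, by rw [map_neg, ← hφK]⟩
    rw [mem_closedBall_zero_iff, norm_neg]
    refine (norm_sub_le _ _).trans (add_le_add ?_ ?_)
    · simpa [hφ1] using B.le_opNorm (φ k)
    · rw [norm_smul, hφ1, mul_one, Real.norm_eq_abs]
      have h1 : 1 / ((k : ℝ) + 1) ≤ 1 := by
        rw [div_le_one (by positivity)]; linarith [(Nat.cast_nonneg k : (0 : ℝ) ≤ k)]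
      have h2 := abs_add_le (μ k - lam) lam
      rw [sub_add_cancel] at h2
      linarith [hμ k]
  obtain ⟨φ₀, -, σ, hσ, hlim⟩ := hcpt.tendsto_subseq hmem
  have hμσ := hμl.comp hσ.tendsto_atTop
  have hE : φ₀ ∈ formEigenspace J B lam := by
    rw [mem_formEigenspace]
    have h1 : Filter.Tendsto (fun k => φ (σ k) + K (B (φ (σ k)) - μ (σ k) • φ (σ k)))
        Filter.atTop (nhds (φ₀ + K (B φ₀ - lam • φ₀))) :=
      hlim.add ((K.continuous.tendsto _).comp
        (((B.continuous.tendsto _).comp hlim).sub (hμσ.smul hlim)))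
    refine tendsto_nhds_unique h1 (tendsto_const_nhds.congr fun k => ?_)
    exact (mem_formEigenspace.mp (hφ (σ k))).symm
  have horth : ∀ k, ⟪φ k, φ₀⟫_ℝ = 0 := by
    intro k
    have h1 := inner_residual_eq_zero hB (lam := lam) (φ := φ k) (f := (μ k - lam) • φ k)
      (ψ := φ₀) (by
        have h2 := mem_formEigenspace.mp (hφ k)
        have : B (φ k) - lam • φ k = (B (φ k) - μ k • φ k) + (μ k - lam) • φ k := by module
        rw [this, map_add, map_add, ← add_assoc, h2, zero_add]) hE
    rw [real_inner_smul_left] at h1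
    exact (mul_eq_zero.mp h1).resolve_left (sub_ne_zero.mpr (hne k))
  have h0 : ⟪φ₀, φ₀⟫_ℝ = 0 :=
    tendsto_nhds_unique (hlim.inner tendsto_const_nhds)
      (tendsto_const_nhds.congr fun k => (horth (σ k)).symm)
  have h1 : ‖φ₀‖ = 1 := tendsto_nhds_unique hlim.norm
    (tendsto_const_nhds.congr fun k => (hφ1 (σ k)).symm)
  rw [inner_self_eq_zero] at h0
  rw [h0, norm_zero] at h1
  exact zero_ne_one h1

/-! ### Perturbation of eigenvalues and generic simplicity -/

/-- First-order perturbation estimate. If `μ` has distance at least `δ` from all other eigenvalues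
of the perturbed operator, then on the eigenspace of `lam` the form of `B' - B` is the scalar `μ - lam` up to
an error that is quadratic in the perturbation: replacing `ψ` by its projection on the perturbed
eigenspace costs a first-order error, and the pairing with that projection vanishes. -/
lemma abs_inner_perturbation_le {J : H →L[ℝ] X} (hJ : IsCompactOperator J) {B B' : X →L[ℝ] X}
    (hB' : (B' : X →ₗ[ℝ] X).IsSymmetric) {lam μ δ : ℝ} (hδ : 0 < δ)
    (hgap : ∀ ν, ν ≠ μ → |ν - μ| < δ → formEigenspace J B' ν = ⊥)
    {φ ψ : X} (hφ : φ ∈ formEigenspace J B lam) (hψ : ψ ∈ formEigenspace J B lam) :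
    |⟪(B' - B) φ, ψ⟫_ℝ + (lam - μ) * ⟪φ, ψ⟫_ℝ| ≤
      (‖B' - B‖ + |lam - μ|) ^ 2 / δ * (‖φ‖ * ‖ψ‖) := by
  set f : X → X := fun x => (B' - B) x + (lam - μ) • x with hf
  have hfn : ∀ x, ‖f x‖ ≤ (‖B' - B‖ + |lam - μ|) * ‖x‖ := by
    intro x
    refine (norm_add_le _ _).trans ?_
    rw [norm_smul, add_mul, Real.norm_eq_abs]
    gcongr
    exact (B' - B).le_opNorm x
  have hres : ∀ x ∈ formEigenspace J B lam,
      x + J (J.adjoint (B' x - μ • x)) = J (J.adjoint (f x)) := by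
    intro x hx
    rw [mem_formEigenspace] at hx
    have : B' x - μ • x = (B x - lam • x) + f x := by
      simp only [hf, sub_apply]; module
    rw [this, map_add, map_add, ← add_assoc, hx, zero_add]
  set E := formEigenspace J B' μ
  set ρ := ψ - E.starProjection ψ with hρ
  have hρE : ρ ∈ Eᗮ := E.sub_starProjection_mem_orthogonal ψ
  have hPE : E.starProjection ψ ∈ E := E.starProjection_apply_mem ψ
  have hρn : δ * ‖ρ‖ ≤ ‖f ψ‖ := by
    refine gap_mul_norm_le hJ hB' hδ.le hgap hρE ?_
    have h1 := hres ψ hψ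
    have h2 := mem_formEigenspace.mp hPE
    have h3 : B' ρ - μ • ρ = (B' ψ - μ • ψ) - (B' (E.starProjection ψ) -
        μ • E.starProjection ψ) := by
      rw [hρ, map_sub]; module
    rw [h3, map_sub, map_sub, ← h1]
    rw [← sub_eq_zero, ← neg_eq_zero, ← h2, hρ]
    abel
  have horth := inner_residual_eq_zero hB' (hres φ hφ) hPE
  have heq : ⟪(B' - B) φ, ψ⟫_ℝ + (lam - μ) * ⟪φ, ψ⟫_ℝ = ⟪f φ, ρ⟫_ℝ := by
    rw [hρ, inner_sub_right, horth, sub_zero, hf, inner_add_left, real_inner_smul_left]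
  rw [heq]
  have hρn' : ‖ρ‖ ≤ ‖f ψ‖ / δ := by rw [le_div_iff₀ hδ]; linarith
  calc |⟪f φ, ρ⟫_ℝ| ≤ ‖f φ‖ * ‖ρ‖ := abs_real_inner_le_norm _ _
    _ ≤ ((‖B' - B‖ + |lam - μ|) * ‖φ‖) * (((‖B' - B‖ + |lam - μ|) * ‖ψ‖) / δ) := by
        gcongr
        · exact hfn φ
        · exact hρn'.trans (by gcongr; exact hfn ψ)
    _ = _ := by ring

/-- If in the direction `D` no eigenvalue splits off from `lam`, then the form of `D` is a multiple
of the inner product on the eigenspace of `lam`. -/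
lemma inner_eq_of_unique_eigenvalue {J : H →L[ℝ] X} (hJ : IsCompactOperator J) {B D : X →L[ℝ] X}
    (hB : (B : X →ₗ[ℝ] X).IsSymmetric) (hD : (D : X →ₗ[ℝ] X).IsSymmetric) {lam p q : ℝ}
    (hp : p < lam) (hq : lam < q)
    {t₀ : ℝ} (ht₀ : 0 < t₀) (huniq : ∀ t, 0 < t → t < t₀ → ∀ μ ν, p < μ → μ < q → p < ν → ν < q →
      formEigenspace J (B + t • D) μ ≠ ⊥ → formEigenspace J (B + t • D) ν ≠ ⊥ → μ = ν)
    {φ ψ : X} (hφ : φ ∈ formEigenspace J B lam) (hψ : ψ ∈ formEigenspace J B lam)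
    (hφ1 : ‖φ‖ = 1) (hψ1 : ‖ψ‖ = 1) (hφψ : ⟪φ, ψ⟫_ℝ = 0) :
    ⟪D φ, ψ⟫_ℝ = 0 ∧ ⟪D φ, φ⟫_ℝ = ⟪D ψ, ψ⟫_ℝ := by
  have hne : formEigenspace J B lam ≠ ⊥ := by
    intro h
    rw [h, Submodule.mem_bot] at hφ
    rw [hφ, norm_zero] at hφ1
    exact zero_ne_one hφ1
  -- The perturbed eigenvalue stays within `δ` of `lam`, hence at distance at least `δ` from `p` and
  -- `q`, so that it is isolated by `δ`.
  set δ := min (lam - p) (q - lam) / 2 with hδd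
  have hm : 0 < min (lam - p) (q - lam) := lt_min (by linarith) (by linarith)
  have hδ : 0 < δ := by positivity
  have hδp : 2 * δ ≤ lam - p := by
    have := min_le_left (lam - p) (q - lam); rw [hδd]; linarith
  have hδq : 2 * δ ≤ q - lam := by
    have := min_le_right (lam - p) (q - lam); rw [hδd]; linarith
  set C := (2 * ‖D‖ + 1) ^ 2 / δ with hC
  -- Dividing the first-order estimate by `t` leaves an error `C t`.
  have key : ∀ t, 0 < t → t < t₀ → t * (‖D‖ + 1) ≤ δ →
      ∃ κ : ℝ, ∀ x ∈ formEigenspace J B lam, ∀ y ∈ formEigenspace J B lam,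
        |⟪D x, y⟫_ℝ + κ * ⟪x, y⟫_ℝ| ≤ C * t * (‖x‖ * ‖y‖) := by
    intro t ht htt htδ
    have hsym : ((B + t • D : X →L[ℝ] X) : X →ₗ[ℝ] X).IsSymmetric := by
      intro x y
      have h1 := hB x y
      have h2 := hD x y
      simp only [ContinuousLinearMap.coe_coe] at h1 h2
      simp [inner_add_left, inner_add_right, real_inner_smul_left, real_inner_smul_right, h1, h2]
    have hnorm : ‖(B + t • D) - B‖ = t * ‖D‖ := by
      rw [add_sub_cancel_left, norm_smul, Real.norm_eq_abs, abs_of_pos ht]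
    obtain ⟨μ, hμ, hμne⟩ := exists_eigenvalue_near hJ (B := B) hsym (lam := lam)
      (η := t * (‖D‖ + 1)) (by rw [hnorm]; linarith) hne
    have hμ' := abs_lt.mp (hμ.trans_le htδ)
    have hgap : ∀ ν, ν ≠ μ → |ν - μ| < δ → formEigenspace J (B + t • D) ν = ⊥ := by
      intro ν hν hνμ
      by_contra hcon
      have hν' := abs_lt.mp hνμ
      exact hν (huniq t ht htt ν μ (by linarith) (by linarith) (by linarith) (by linarith)
        hcon hμne)
    refine ⟨(lam - μ) / t, fun x hx y hy => ?_⟩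
    have h1 := abs_inner_perturbation_le hJ hsym hδ hgap hx hy
    rw [hnorm, add_sub_cancel_left, smul_apply, real_inner_smul_left] at h1
    have h2 : t * ⟪D x, y⟫_ℝ + (lam - μ) * ⟪x, y⟫_ℝ =
        t * (⟪D x, y⟫_ℝ + (lam - μ) / t * ⟪x, y⟫_ℝ) := by field_simp
    rw [h2, abs_mul, abs_of_pos ht] at h1
    have h3 : (t * ‖D‖ + |lam - μ|) ^ 2 ≤ (t * (2 * ‖D‖ + 1)) ^ 2 := by
      rw [abs_sub_comm] at hμ
      gcongr
      linarith
    have h4 : (t * ‖D‖ + |lam - μ|) ^ 2 / δ * (‖x‖ * ‖y‖) ≤ t * (C * t * (‖x‖ * ‖y‖)) := by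
      have : t * (C * t * (‖x‖ * ‖y‖)) = (t * (2 * ‖D‖ + 1)) ^ 2 / δ * (‖x‖ * ‖y‖) := by
        rw [hC]; ring
      rw [this]
      gcongr
    exact le_of_mul_le_mul_left (h1.trans h4) ht
  have small : ∀ a : ℝ, (∀ t, 0 < t → t < t₀ → t * (‖D‖ + 1) ≤ δ → |a| ≤ 2 * C * t) → a = 0 := by
    intro a ha
    have hC0 : 0 ≤ C := by positivity
    have h1 : ∀ᶠ t : ℝ in nhdsWithin 0 (Ioi 0), |a| ≤ 2 * C * t := by
      have e1 : ∀ᶠ t : ℝ in nhdsWithin 0 (Ioi 0), t < t₀ :=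
        nhdsWithin_le_nhds (eventually_lt_nhds ht₀)
      have e2 : ∀ᶠ t : ℝ in nhdsWithin 0 (Ioi 0), t < δ / (‖D‖ + 1) :=
        nhdsWithin_le_nhds (eventually_lt_nhds (by positivity))
      filter_upwards [e1, e2, self_mem_nhdsWithin] with t h1 h2 h3
      exact ha t h3 h1 (by rw [lt_div_iff₀ (by positivity)] at h2; exact h2.le)
    have h2 : Filter.Tendsto (fun t : ℝ => 2 * C * t) (nhdsWithin 0 (Ioi 0)) (nhds 0) := by
      have : Filter.Tendsto (fun t : ℝ => 2 * C * t) (nhds 0) (nhds (2 * C * 0)) :=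
        (continuous_const.mul continuous_id).tendsto 0
      rw [mul_zero] at this
      exact this.mono_left nhdsWithin_le_nhds
    have := le_of_tendsto_of_tendsto tendsto_const_nhds h2 h1
    exact abs_eq_zero.mp (le_antisymm this (abs_nonneg a))
  have hC0 : 0 ≤ C := by positivity
  constructor
  · refine small _ fun t h1 h2 h3 => ?_
    obtain ⟨κ, hκ⟩ := key t h1 h2 h3
    have := hκ φ hφ ψ hψ
    rw [hφψ, hφ1, hψ1, mul_zero, add_zero, mul_one, mul_one] at this
    nlinarith [mul_nonneg hC0 h1.le]
  · rw [← sub_eq_zero]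
    refine small _ fun t h1 h2 h3 => ?_
    obtain ⟨κ, hκ⟩ := key t h1 h2 h3
    have e1 := hκ φ hφ φ hφ
    have e2 := hκ ψ hψ ψ hψ
    rw [real_inner_self_eq_norm_sq φ, hφ1] at e1
    rw [real_inner_self_eq_norm_sq ψ, hψ1] at e2
    rw [abs_le] at e1 e2 ⊢
    constructor <;> linarith [e1.1, e1.2, e2.1, e2.2]

/-- Suppose that the perturbations `m β` separate directions: their forms are not all scalar on a
two-dimensional space. Then for a dense set of `b` all eigenspaces of the operator with potential
`B + m b` have dimension at most one, stated as: two orthogonal eigenvectors for the same eigenvalue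
cannot both be nonzero. -/
theorem dense_setOf_simple_eigenspaces {Y : Type*} [NormedAddCommGroup Y] [NormedSpace ℝ Y] [CompleteSpace Y]
    {J : H →L[ℝ] X} (hJ : IsCompactOperator J) {B : X →L[ℝ] X}
    (hB : (B : X →ₗ[ℝ] X).IsSymmetric) (m : Y →L[ℝ] X →L[ℝ] X)
    (hm : ∀ b, (m b : X →ₗ[ℝ] X).IsSymmetric)
    (hnd : ∀ φ ψ : X, (∀ β, ⟪m β φ, ψ⟫_ℝ = 0) → (∀ β, ⟪m β φ, φ⟫_ℝ = ⟪m β ψ, ψ⟫_ℝ) → φ = 0) :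
    Dense {b : Y | ∀ lam, ∀ φ ∈ formEigenspace J (B + m b) lam,
      ∀ ψ ∈ formEigenspace J (B + m b) lam, ⟪φ, ψ⟫_ℝ = 0 → φ = 0 ∨ ψ = 0} := by
  have hsym : ∀ b, ((B + m b : X →L[ℝ] X) : X →ₗ[ℝ] X).IsSymmetric := fun b =>
    hB.add (hm b)
  -- The parameters with at least two distinct eigenvalues in a given rational interval.
  let W : ℚ × ℚ → Set Y := fun r => {b | ∃ μ ν : ℝ, μ ≠ ν ∧ r.1 < μ ∧ μ < r.2 ∧ r.1 < ν ∧ ν < r.2 ∧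
    formEigenspace J (B + m b) μ ≠ ⊥ ∧ formEigenspace J (B + m b) ν ≠ ⊥}
  have hW : ∀ r, IsOpen (W r) := by
    intro r
    rw [Metric.isOpen_iff]
    rintro b ⟨μ, ν, hμν, h1, h2, h3, h4, hμ, hν⟩
    obtain ⟨η, hη, hηs⟩ : ∃ η > 0, η ≤ μ - r.1 ∧ η ≤ r.2 - μ ∧ η ≤ ν - r.1 ∧ η ≤ r.2 - ν ∧
        2 * η ≤ |μ - ν| := by
      refine ⟨min (min (μ - r.1) (r.2 - μ)) (min (min (ν - r.1) (r.2 - ν)) (|μ - ν| / 2)), ?_, ?_⟩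
      · have : 0 < |μ - ν| := abs_pos.mpr (sub_ne_zero.mpr hμν)
        simp only [gt_iff_lt, lt_min_iff]
        refine ⟨⟨?_, ?_⟩, ⟨?_, ?_⟩, ?_⟩ <;> linarith
      · have h := le_refl (min (min (μ - r.1) (r.2 - μ))
          (min (min (ν - r.1) (r.2 - ν)) (|μ - ν| / 2)))
        simp only [le_min_iff] at h
        refine ⟨h.1.1, h.1.2, h.2.1.1, h.2.1.2, ?_⟩
        linarith [h.2.2]
    refine ⟨η / (‖m‖ + 1), by positivity, fun b' hb' => ?_⟩
    have hnorm : ‖(B + m b') - (B + m b)‖ < η := by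
      rw [mem_ball_iff_norm, lt_div_iff₀ (by positivity)] at hb'
      rw [add_sub_add_left_eq_sub, ← map_sub]
      have := m.le_opNorm (b' - b)
      nlinarith [norm_nonneg (b' - b)]
    obtain ⟨μ', hμ', hμ''⟩ := exists_eigenvalue_near hJ (hsym b') hnorm hμ
    obtain ⟨ν', hν', hν''⟩ := exists_eigenvalue_near hJ (hsym b') hnorm hν
    refine ⟨μ', ν', ?_, ?_⟩
    · rintro rfl
      have := abs_sub_le μ μ' ν
      rw [abs_sub_comm μ μ'] at this
      linarith
    · rw [abs_lt] at hμ' hν'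
      exact ⟨by linarith, by linarith, by linarith, by linarith, hμ'', hν''⟩
  -- Baire's theorem: the frontier of an open set is closed with empty interior.
  have hdense : Dense (⋂ r, (frontier (W r))ᶜ) := by
    refine dense_iInter_of_isOpen (fun r => isClosed_frontier.isOpen_compl) fun r => ?_
    rw [← interior_eq_empty_iff_dense_compl]
    exact interior_frontier (hW r).isClosed_compl |> fun h => by rwa [frontier_compl] at h
  refine hdense.mono fun b hb lam φ hφ ψ hψ hφψ => ?_
  by_contra! hne
  obtain ⟨hφ0, hψ0⟩ := hne
  set φ' := ‖φ‖⁻¹ • φ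
  set ψ' := ‖ψ‖⁻¹ • ψ
  have hφ' : φ' ∈ formEigenspace J (B + m b) lam := Submodule.smul_mem _ _ hφ
  have hψ' : ψ' ∈ formEigenspace J (B + m b) lam := Submodule.smul_mem _ _ hψ
  have hφ1 : ‖φ'‖ = 1 := norm_smul_inv_norm hφ0
  have hψ1 : ‖ψ'‖ = 1 := norm_smul_inv_norm hψ0
  have h01 : ⟪φ', ψ'⟫_ℝ = 0 := by
    rw [real_inner_smul_left, real_inner_smul_right, hφψ, mul_zero, mul_zero]
  obtain ⟨δ, hδ, hiso⟩ := exists_isolated hJ (hsym b) lam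
  obtain ⟨p, hp1, hp2⟩ := exists_rat_btwn (show lam - δ < lam by linarith)
  obtain ⟨q, hq1, hq2⟩ := exists_rat_btwn (show lam < lam + δ by linarith)
  have hbW : b ∉ W (p, q) := by
    rintro ⟨μ, ν, hμν, h1, h2, h3, h4, hμ, hν⟩
    simp only at h1 h2 h3 h4
    have e : ∀ x : ℝ, p < x → x < q → formEigenspace J (B + m b) x ≠ ⊥ → x = lam := by
      intro x hx1 hx2 hx
      by_contra hxl
      exact hx (hiso x hxl (abs_lt.mpr ⟨by linarith, by linarith⟩))
    exact hμν ((e μ h1 h2 hμ).trans (e ν h3 h4 hν).symm)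
  have hbc : b ∈ (closure (W (p, q)))ᶜ := by
    intro hcl
    have h1 := mem_iInter.mp hb (p, q)
    rw [(hW _).frontier_eq] at h1
    exact h1 ⟨hcl, hbW⟩
  obtain ⟨r, hr, hball⟩ := Metric.isOpen_iff.mp isClosed_closure.isOpen_compl b hbc
  have hfin : ∀ β, ⟪m β φ', ψ'⟫_ℝ = 0 ∧ ⟪m β φ', φ'⟫_ℝ = ⟪m β ψ', ψ'⟫_ℝ := by
    intro β
    refine inner_eq_of_unique_eigenvalue hJ (hsym b) (hm β) hp2 hq1
      (t₀ := r / (‖β‖ + 1)) (by positivity) ?_ hφ' hψ' hφ1 hψ1 h01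
    intro t ht htt μ ν h1 h2 h3 h4 hμ hν
    by_contra hμν
    have hmem : b + t • β ∈ Metric.ball b r := by
      rw [mem_ball_iff_norm, add_sub_cancel_left, norm_smul, Real.norm_eq_abs, abs_of_pos ht]
      rw [lt_div_iff₀ (by positivity)] at htt
      linarith
    refine hball hmem (subset_closure ⟨μ, ν, hμν, h1, h2, h3, h4, ?_⟩)
    rw [map_add, map_smul, ← add_assoc]
    exact ⟨hμ, hν⟩
  have := hnd φ' ψ' (fun β => (hfin β).1) (fun β => (hfin β).2)
  rw [this, norm_zero] at hφ1
  exact zero_ne_one hφ1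

end Abstract

/-! ### Averages over cubes -/

lemma norm_sq_eq_integral {α : Type*} [MeasurableSpace α] {μ : Measure α} (u : Lp ℝ 2 μ) :
    ‖u‖ ^ 2 = ∫ x, u x ^ 2 ∂μ := by
  rw [← real_inner_self_eq_norm_sq, L2.inner_def]
  refine integral_congr_ae (Filter.Eventually.of_forall fun x => ?_)
  simp [sq]

section Averaging
variable {α : Type*} [MeasurableSpace α] {μ : Measure α} [SFinite μ]

lemma setIntegral_sq_sub {Q : Set α} (hQ : μ Q ≠ ⊤) {u : α → ℝ} (hu : MemLp u 2 μ) :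
    ∫ p in Q ×ˢ Q, (u p.1 - u p.2) ^ 2 ∂μ.prod μ =
      2 * (μ.real Q * ∫ x in Q, u x ^ 2 ∂μ - (∫ x in Q, u x ∂μ) ^ 2) := by
  have : IsFiniteMeasure (μ.restrict Q) := ⟨by simpa using hQ.lt_top⟩
  have hu' : MemLp u 2 (μ.restrict Q) := hu.restrict Q
  have h1 : Integrable u (μ.restrict Q) := hu'.integrable (by norm_num)
  have h2 : Integrable (fun x => u x ^ 2) (μ.restrict Q) := hu'.integrable_sq
  rw [← Measure.prod_restrict]
  have e : ∀ p : α × α, (u p.1 - u p.2) ^ 2 = u p.1 ^ 2 + u p.2 ^ 2 - 2 * (u p.1 * u p.2) := by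
    intro p; ring
  simp_rw [e]
  have h3 : Integrable (fun p : α × α => u p.1 ^ 2 + u p.2 ^ 2)
      ((μ.restrict Q).prod (μ.restrict Q)) := (h2.comp_fst _).add (h2.comp_snd _)
  rw [integral_sub h3 ((h1.mul_prod h1).const_mul 2),
    integral_add (h2.comp_fst _) (h2.comp_snd _), integral_const_mul, integral_prod_mul,
    integral_fun_fst (fun x => u x ^ 2), integral_fun_snd (fun x => u x ^ 2)]
  simp only [measureReal_restrict_apply_univ, smul_eq_mul]
  ring

/-- Averaging over the sets `Q i`, `i ∈ S`, is an orthogonal projection of finite rank in `L²`, and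
its error is controlled by the oscillation of `u` on each `Q i`. -/
lemma exists_compact_average {ι : Type*} (S : Finset ι) (Q : ι → Set α)
    (hQ : ∀ i, MeasurableSet (Q i)) (hpos : ∀ i, 0 < μ (Q i)) (hfin : ∀ i, μ (Q i) ≠ ⊤)
    (hdisj : Pairwise (Function.onFun Disjoint Q)) :
    ∃ P : Lp ℝ 2 μ →L[ℝ] Lp ℝ 2 μ, IsCompactOperator P ∧
      ∀ u : Lp ℝ 2 μ, (∀ᵐ x ∂μ, x ∉ ⋃ i ∈ S, Q i → u x = 0) →
        ‖u - P u‖ ^ 2 = ∑ i ∈ S, (2 * μ.real (Q i))⁻¹ *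
          ∫ p in Q i ×ˢ Q i, (u p.1 - u p.2) ^ 2 ∂μ.prod μ := by
  let e : ι → Lp ℝ 2 μ := fun i => indicatorConstLp 2 (hQ i) (hfin i) (1 : ℝ)
  have he : ∀ i (u : Lp ℝ 2 μ), ⟪e i, u⟫_ℝ = ∫ x in Q i, u x ∂μ := fun i u =>
    L2.inner_indicatorConstLp_one (hQ i) (hfin i) u
  have hpos' : ∀ i, 0 < μ.real (Q i) := fun i => ENNReal.toReal_pos (hpos i).ne' (hfin i)
  have hee : ∀ i, ⟪e i, e i⟫_ℝ = μ.real (Q i) := by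
    intro i
    rw [he, setIntegral_indicatorConstLp (hQ i)]
    simp
  have hee' : ∀ i j, i ≠ j → ⟪e i, e j⟫_ℝ = 0 := by
    intro i j hij
    rw [he, setIntegral_indicatorConstLp (hQ i), (hdisj hij.symm).inter_eq]
    simp
  let P : Lp ℝ 2 μ →L[ℝ] Lp ℝ 2 μ :=
    ∑ i ∈ S, (μ.real (Q i))⁻¹ • InnerProductSpace.rankOne ℝ (e i) (e i)
  have hP : ∀ u, P u = ∑ i ∈ S, ((μ.real (Q i))⁻¹ * ⟪e i, u⟫_ℝ) • e i := by
    intro u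
    simp [P, smul_smul]
  refine ⟨P, ?_, fun u hu => ?_⟩
  · change P ∈ compactOperator (RingHom.id ℝ) (Lp ℝ 2 μ) (Lp ℝ 2 μ)
    refine Submodule.sum_mem _ fun i _ => Submodule.smul_mem _ _ ?_
    change IsCompactOperator (InnerProductSpace.rankOne ℝ (e i) (e i))
    rw [InnerProductSpace.rankOne_def']
    exact (isCompactOperator_of_locallyCompactSpace_rng
      (ContinuousLinearMap.toSpanSingleton ℝ (e i))).comp_clm _
  · have hr : ∀ j ∈ S, ⟪e j, u - P u⟫_ℝ = 0 := by
      intro j hj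
      rw [inner_sub_right, hP, inner_sum, Finset.sum_eq_single j]
      · rw [real_inner_smul_right, hee]
        have := (hpos' j).ne'
        field_simp
        ring
      · intro i _ hij
        rw [real_inner_smul_right, hee' j i hij.symm, mul_zero]
      · exact fun h => absurd hj h
    have h1 : ⟪u - P u, P u⟫_ℝ = 0 := by
      rw [hP u, inner_sum]
      refine Finset.sum_eq_zero fun i hi => ?_
      rw [real_inner_smul_right, real_inner_comm (e i) (u - _), ← hP, hr i hi, mul_zero]
    have h2 : ‖u - P u‖ ^ 2 = ‖u‖ ^ 2 - ⟪P u, u⟫_ℝ := by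
      rw [← real_inner_self_eq_norm_sq, inner_sub_right, h1, sub_zero, inner_sub_left,
        real_inner_self_eq_norm_sq]
    have h3 : ‖u‖ ^ 2 = ∑ i ∈ S, ∫ x in Q i, u x ^ 2 ∂μ := by
      rw [norm_sq_eq_integral, ← integral_biUnion_finset S (fun i _ => hQ i)
        (fun i _ j _ hij => hdisj hij) (fun i _ => (Lp.memLp u).integrable_sq.integrableOn)]
      symm
      refine setIntegral_eq_integral_of_ae_compl_eq_zero ?_
      filter_upwards [hu] with x hx hxQ
      rw [hx hxQ]; simp
    rw [h2, h3, hP, sum_inner, ← Finset.sum_sub_distrib]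
    refine Finset.sum_congr rfl fun i _ => ?_
    rw [setIntegral_sq_sub (hfin i) (Lp.memLp u), real_inner_smul_left, he]
    have := (hpos' i).ne'
    field_simp

end Averaging

section Cubes
variable {n : ℕ}

/-- The half-open cube of side `h` with lower corner `h k` of the grid `h ℤⁿ`. -/
def gridCube (h : ℝ) (k : Fin n → ℤ) : Set (Space n) := {x | ∀ i, ⌊x i / h⌋ = k i}

lemma gridCube_disjoint (h : ℝ) :
    Pairwise (Function.onFun Disjoint (gridCube h : (Fin n → ℤ) → Set (Space n))) := by
  intro k l hkl
  refine Set.disjoint_left.mpr fun x hx hy => hkl ?_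
  ext i
  rw [← hx i, hy i]

lemma gridCube_eq {h : ℝ} (hh : 0 < h) (k : Fin n → ℤ) :
    gridCube h k = (WithLp.ofLp : Space n → Fin n → ℝ) ⁻¹'
      Set.pi univ fun i => Ico (k i * h) ((k i + 1) * h) := by
  ext x
  simp only [gridCube, mem_ofPred_eq, mem_preimage, mem_pi, mem_univ, true_imp_iff, mem_Ico,
    Int.floor_eq_iff, le_div_iff₀ hh, div_lt_iff₀ hh]

lemma measurableSet_gridCube {h : ℝ} (hh : 0 < h) (k : Fin n → ℤ) :
    MeasurableSet (gridCube h k) := by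
  rw [gridCube_eq hh]
  exact (PiLp.volume_preserving_ofLp (Fin n)).measurable
    (MeasurableSet.univ_pi fun i => measurableSet_Ico)

lemma volume_gridCube {h : ℝ} (hh : 0 < h) (k : Fin n → ℤ) :
    volume (gridCube h k) = ENNReal.ofReal (h ^ n) := by
  rw [gridCube_eq hh, (PiLp.volume_preserving_ofLp (Fin n)).measure_preimage
    (MeasurableSet.univ_pi fun i => measurableSet_Ico).nullMeasurableSet, Real.volume_pi_Ico]
  have : ∀ i, ((k i : ℝ) + 1) * h - k i * h = h := fun i => by ring
  simp [this, ENNReal.ofReal_pow hh.le]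

lemma norm_sub_le_of_mem_gridCube {h : ℝ} (hh : 0 < h) {k : Fin n → ℤ} {x y : Space n}
    (hx : x ∈ gridCube h k) (hy : y ∈ gridCube h k) : ‖x - y‖ ≤ √n * h := by
  rw [gridCube_eq hh] at hx hy
  rw [EuclideanSpace.norm_eq, ← Real.sqrt_sq hh.le, ← Real.sqrt_mul (by positivity)]
  refine Real.sqrt_le_sqrt ?_
  have : ∀ i ∈ Finset.univ, ‖(x - y) i‖ ^ 2 ≤ h ^ 2 := by
    intro i _
    have h1 := hx i (mem_univ i)
    have h2 := hy i (mem_univ i)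
    simp only [mem_Ico] at h1 h2
    rw [Real.norm_eq_abs]
    refine pow_le_pow_left₀ (abs_nonneg _) (abs_le.mpr ⟨?_, ?_⟩) 2 <;>
      simp only [PiLp.sub_apply] <;> linarith [h1.1, h1.2, h2.1, h2.2]
  refine (Finset.sum_le_sum this).trans ?_
  simp

lemma exists_finset_gridCube {Ω : Set (Space n)} (hΩ : Bornology.IsBounded Ω) {h : ℝ}
    (hh : 0 < h) : ∃ S : Finset (Fin n → ℤ), Ω ⊆ ⋃ k ∈ S, gridCube h k := by
  obtain ⟨R, hR⟩ := hΩ.exists_norm_le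
  refine ⟨Fintype.piFinset fun _ => Finset.Icc ⌊-R / h⌋ ⌊R / h⌋, fun x hx => ?_⟩
  refine mem_iUnion₂.mpr ⟨fun i => ⌊x i / h⌋, ?_, fun i => rfl⟩
  rw [Fintype.mem_piFinset]
  intro i
  have h1 := abs_le.mp ((PiLp.norm_apply_le x i).trans (hR x hx))
  rw [Finset.mem_Icc]
  constructor <;> refine Int.floor_le_floor ?_ <;> gcongr
  · exact h1.1
  · exact h1.2

end Cubes

/-! ### The energy space and Rellich's theorem -/

variable {n : ℕ}

lemma normConst_pos (hn : 1 ≤ n) {s : ℝ} (hs0 : 0 < s) (hs1 : s < 1) : 0 < normConst n s := by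
  have h1 : 0 < Real.Gamma (s + (n : ℝ) / 2) := Real.Gamma_pos_of_pos (by positivity)
  have h2 : 0 < Real.Gamma (1 - s) := Real.Gamma_pos_of_pos (by linarith)
  have := Real.pi_pos
  unfold normConst
  positivity

/-- `L²(ℝⁿ × ℝⁿ)`. -/
abbrev L2Prod (n : ℕ) : Type := Lp ℝ 2 (volume : Measure (Space n × Space n))

/-- The Hilbert space `L²(ℝⁿ) ⊕ L²(ℝⁿ × ℝⁿ)`. -/
abbrev PairSpace (n : ℕ) : Type := WithLp 2 (L2 n × L2Prod n)

lemma gagliardoQuotient_add {s : ℝ} (u v : L2 n) :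
    ∀ᵐ p : Space n × Space n, gagliardoQuotient s (u + v : L2 n) p =
      gagliardoQuotient s u p + gagliardoQuotient s v p := by
  filter_upwards [ae_prod_of_ae (Lp.coeFn_add u v)] with p hp
  simp only [gagliardoQuotient, hp.1, hp.2, Pi.add_apply]
  ring

lemma gagliardoQuotient_smul {s : ℝ} (c : ℝ) (u : L2 n) :
    ∀ᵐ p : Space n × Space n, gagliardoQuotient s (c • u : L2 n) p =
      c * gagliardoQuotient s u p := by
  filter_upwards [ae_prod_of_ae (Lp.coeFn_smul c u)] with p hp
  simp only [gagliardoQuotient, hp.1, hp.2, Pi.smul_apply, smul_eq_mul]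
  ring

/-- `𝓗₀ˢ(Ω)` as a Hilbert space with inner product `⟨u, v⟩ + 𝓔(u, v)`. It is encoded as the graph of
`u ↦ √(C_{n,s} / 2) (u(x) - u(y)) / |x - y|^{n/2 + s}` in `L²(ℝⁿ) ⊕ L²(ℝⁿ × ℝⁿ)`, from which it
inherits its inner product. -/
def energySpace (s : ℝ) (Ω : Set (Space n)) : Submodule ℝ (PairSpace n) where
  carrier := {U | (∀ᵐ x, x ∉ Ω → U.fst x = 0) ∧
    ∀ᵐ p, U.snd p = √(normConst n s / 2) * gagliardoQuotient s U.fst p}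
  zero_mem' := by
    have h0 := Lp.coeFn_zero ℝ 2 (volume : Measure (Space n))
    refine ⟨?_, ?_⟩
    · filter_upwards [h0] with x hx _
      rw [WithLp.zero_fst, hx, Pi.zero_apply]
    · filter_upwards [ae_prod_of_ae h0, Lp.coeFn_zero ℝ 2 (volume : Measure (Space n × Space n))]
        with p hp hp'
      rw [WithLp.zero_snd, hp', WithLp.zero_fst, gagliardoQuotient, hp.1, hp.2]
      simp
  add_mem' := by
    rintro U W ⟨hU1, hU2⟩ ⟨hW1, hW2⟩
    refine ⟨?_, ?_⟩
    · filter_upwards [Lp.coeFn_add U.fst W.fst, hU1, hW1] with x hx h1 h2 hxΩ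
      rw [WithLp.add_fst, hx, Pi.add_apply, h1 hxΩ, h2 hxΩ, add_zero]
    · filter_upwards [Lp.coeFn_add U.snd W.snd, gagliardoQuotient_add (s := s) U.fst W.fst,
        hU2, hW2] with p hp hq h1 h2
      rw [WithLp.add_snd, hp, Pi.add_apply, h1, h2, WithLp.add_fst, hq, mul_add]
  smul_mem' := by
    rintro c U ⟨hU1, hU2⟩
    refine ⟨?_, ?_⟩
    · filter_upwards [Lp.coeFn_smul c U.fst, hU1] with x hx h1 hxΩ
      rw [WithLp.smul_fst, hx, Pi.smul_apply, h1 hxΩ, smul_zero]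
    · filter_upwards [Lp.coeFn_smul c U.snd, gagliardoQuotient_smul (s := s) c U.fst, hU2]
        with p hp hq h1
      rw [WithLp.smul_snd, hp, Pi.smul_apply, h1, WithLp.smul_fst, hq, smul_eq_mul]
      ring

/-- Both conditions defining the graph survive almost everywhere convergence along a subsequence. -/
lemma isClosed_energySpace (s : ℝ) (Ω : Set (Space n)) :
    IsClosed (energySpace s Ω : Set (PairSpace n)) := by
  refine IsSeqClosed.isClosed fun U W hU hlim => ?_
  have h1 : Filter.Tendsto (fun k => (U k).fst) Filter.atTop (nhds W.fst) :=
    ((WithLp.fstL 2 ℝ (L2 n) (L2Prod n)).continuous.tendsto W).comp hlim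
  have h2 : Filter.Tendsto (fun k => (U k).snd) Filter.atTop (nhds W.snd) :=
    ((WithLp.sndL 2 ℝ (L2 n) (L2Prod n)).continuous.tendsto W).comp hlim
  obtain ⟨σ, hσ, hσlim⟩ := (tendstoInMeasure_of_tendsto_Lp h1).exists_seq_tendsto_ae
  obtain ⟨τ, hτ, hτlim⟩ := (tendstoInMeasure_of_tendsto_Lp
    (h2.comp hσ.tendsto_atTop)).exists_seq_tendsto_ae
  have hU1 : ∀ᵐ x, ∀ k, x ∉ Ω → (U k).fst x = 0 := ae_all_iff.mpr fun k => (hU k).1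
  have hU2 : ∀ᵐ p, ∀ k, (U k).snd p =
    √(normConst n s / 2) * gagliardoQuotient s (U k).fst p := ae_all_iff.mpr fun k => (hU k).2
  refine ⟨?_, ?_⟩
  · filter_upwards [hU1, hσlim] with x hx hl hxΩ
    exact tendsto_nhds_unique hl (tendsto_const_nhds.congr fun k => (hx (σ k) hxΩ).symm)
  · filter_upwards [hU2, hτlim, ae_prod_of_ae hσlim] with p hp hl hl'
    refine tendsto_nhds_unique hl ?_
    have h3 := ((hl'.1.sub hl'.2).div_const (‖p.1 - p.2‖ ^ ((n : ℝ) / 2 + s))).const_mul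
      √(normConst n s / 2)
    refine (h3.comp hτ.tendsto_atTop).congr fun k => ?_
    simp only [Function.comp_apply, hp, gagliardoQuotient]

instance (s : ℝ) (Ω : Set (Space n)) : CompleteSpace (energySpace s Ω) :=
  (isClosed_energySpace s Ω).completeSpace_coe

/-- The inclusion of `𝓗₀ˢ(Ω)` in `L²(ℝⁿ)`. -/
def embedding (s : ℝ) (Ω : Set (Space n)) : energySpace s Ω →L[ℝ] L2 n :=
  WithLp.fstL 2 ℝ (L2 n) (L2Prod n) ∘L (energySpace s Ω).subtypeL

lemma embedding_apply {s : ℝ} {Ω : Set (Space n)} (U : energySpace s Ω) :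
    embedding s Ω U = (U : PairSpace n).fst := rfl

lemma embedding_mem {s : ℝ} (hC : 0 < normConst n s) {Ω : Set (Space n)} (U : energySpace s Ω) :
    embedding s Ω U ∈ Hs0 s Ω := by
  refine ⟨?_, U.2.1⟩
  have hκ : 0 < √(normConst n s / 2) := by positivity
  refine ((Lp.memLp (U : PairSpace n).snd).const_mul (√(normConst n s / 2))⁻¹).ae_eq ?_
  filter_upwards [U.2.2] with p hp
  rw [hp, inv_mul_cancel_left₀ hκ.ne']
  rfl

lemma exists_embedding_eq {s : ℝ} {Ω : Set (Space n)} {u : L2 n} (hu : u ∈ Hs0 s Ω) :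
    ∃ U : energySpace s Ω, embedding s Ω U = u := by
  have hmem : MemLp (fun p => √(normConst n s / 2) * gagliardoQuotient s u p) 2
    (volume : Measure (Space n × Space n)) := MemLp.const_mul hu.1 _
  exact ⟨⟨WithLp.toLp 2 (u, hmem.toLp _), hu.2, hmem.coeFn_toLp⟩, rfl⟩

lemma inner_energySpace {s : ℝ} (hC : 0 ≤ normConst n s) {Ω : Set (Space n)}
    (U W : energySpace s Ω) :
    ⟪U, W⟫_ℝ = ⟪embedding s Ω U, embedding s Ω W⟫_ℝ +
      energy s (embedding s Ω U) (embedding s Ω W) := by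
  rw [Submodule.coe_inner, WithLp.prod_inner_apply]
  congr 1
  rw [L2.inner_def, energy, ← integral_const_mul]
  refine integral_congr_ae ?_
  filter_upwards [U.2.2, W.2.2] with p h1 h2
  change ⟪(U : PairSpace n).snd p, (W : PairSpace n).snd p⟫_ℝ = _
  rw [h1, h2]
  have h3 : ‖p.1 - p.2‖ ^ ((n : ℝ) + 2 * s) = (‖p.1 - p.2‖ ^ ((n : ℝ) / 2 + s)) ^ 2 := by
    rw [← Real.rpow_natCast, ← Real.rpow_mul (norm_nonneg _)]
    congr 1; push_cast; ring
  have h4 : √(normConst n s / 2) ^ 2 = normConst n s / 2 := Real.sq_sqrt (by positivity)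
  simp only [RCLike.inner_apply, conj_trivial, gagliardoQuotient, embedding_apply]
  rw [h3]
  generalize √(normConst n s / 2) = κ at h4
  rw [← h4]
  ring

/-- Averaging over the cubes of side `h` that cover `Ω` approximates the elements of `𝓗₀ˢ(Ω)` up to
`O(h^s)`: on a cube, `(u(x) - u(y))²` is at most `(√n h)^{n+2s}` times the squared Gagliardo quotient,
and the mean over the cube divides by its volume `h^n`. -/
lemma exists_compact_approx (hn : 1 ≤ n) {s : ℝ} (hs : 0 < s) (hC : 0 < normConst n s)
    {Ω : Set (Space n)} (hΩ : Bornology.IsBounded Ω) {h : ℝ} (hh : 0 < h) :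
    ∃ P : L2 n →L[ℝ] L2 n, IsCompactOperator P ∧ ∀ U : energySpace s Ω,
      ‖embedding s Ω U - P (embedding s Ω U)‖ ^ 2 ≤
        ((√n) ^ ((n : ℝ) + 2 * s) / normConst n s * h ^ (2 * s)) * ‖U‖ ^ 2 := by
  obtain ⟨S, hS⟩ := exists_finset_gridCube hΩ hh
  obtain ⟨P, hPc, hP⟩ := exists_compact_average (μ := (volume : Measure (Space n))) S (gridCube h)
    (fun k => measurableSet_gridCube hh k)
    (fun k => by rw [volume_gridCube hh]; exact ENNReal.ofReal_pos.mpr (by positivity))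
    (fun k => by rw [volume_gridCube hh]; exact ENNReal.ofReal_ne_top)
    (gridCube_disjoint h)
  refine ⟨P, hPc, fun U => ?_⟩
  have hvol : ∀ k : Fin n → ℤ, (volume : Measure (Space n)).real (gridCube h k) = h ^ n := fun k => by
    rw [Measure.real, volume_gridCube hh, ENNReal.toReal_ofReal (by positivity)]
  set u := embedding s Ω U with hu
  set g := (U : PairSpace n).snd with hg
  rw [hP u (by filter_upwards [U.2.1] with x hx hxS; exact hx fun h => hxS (hS h))]
  simp_rw [hvol]
  set d := √n * h with hd
  set κ := √(normConst n s / 2) with hκd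
  have hκ : 0 < κ := by positivity
  have hκ2 : κ ^ 2 = normConst n s / 2 := Real.sq_sqrt (by positivity)
  have hgi : Integrable (fun p => g p ^ 2) := (Lp.memLp g).integrable_sq
  have hpt : ∀ᵐ p : Space n × Space n, ∀ k, p ∈ gridCube h k ×ˢ gridCube h k →
      (u p.1 - u p.2) ^ 2 ≤ d ^ ((n : ℝ) + 2 * s) / κ ^ 2 * g p ^ 2 := by
    filter_upwards [U.2.2] with p hp k hpk
    rw [hg, hp, ← hκd, mul_pow, div_mul_eq_mul_div, mul_left_comm,
      mul_div_cancel_left₀ _ (by positivity), gagliardoQuotient, ← embedding_apply, ← hu]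
    rcases eq_or_ne (‖p.1 - p.2‖) 0 with h0 | h0
    · rw [norm_eq_zero, sub_eq_zero] at h0
      rw [h0]; simp
    · have h1 : 0 < ‖p.1 - p.2‖ := lt_of_le_of_ne (norm_nonneg _) h0.symm
      have h3 : (‖p.1 - p.2‖ ^ ((n : ℝ) / 2 + s)) ^ 2 = ‖p.1 - p.2‖ ^ ((n : ℝ) + 2 * s) := by
        rw [← Real.rpow_natCast, ← Real.rpow_mul (norm_nonneg _)]
        congr 1; push_cast; ring
      rw [div_pow, h3, mul_div_assoc', le_div_iff₀ (by positivity), mul_comm]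
      gcongr
      exact norm_sub_le_of_mem_gridCube hh hpk.1 hpk.2
  have hint : ∀ k ∈ S, ∫ p in gridCube h k ×ˢ gridCube h k, (u p.1 - u p.2) ^ 2
      ∂((volume : Measure (Space n)).prod volume) ≤
      d ^ ((n : ℝ) + 2 * s) / κ ^ 2 * ∫ p in gridCube h k ×ˢ gridCube h k, g p ^ 2 := by
    intro k _
    rw [← integral_const_mul]
    refine integral_mono_of_nonneg (Filter.Eventually.of_forall fun p => sq_nonneg _)
      (hgi.integrableOn.const_mul _) ?_
    rw [Filter.EventuallyLE, ae_restrict_iff' ((measurableSet_gridCube hh k).prod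
      (measurableSet_gridCube hh k))]
    filter_upwards [hpt] with p hp
    exact hp k
  have hsum : ∑ k ∈ S, ∫ p in gridCube h k ×ˢ gridCube h k, g p ^ 2 ≤ ‖U‖ ^ 2 := by
    rw [← integral_biUnion_finset S
      (fun k _ => (measurableSet_gridCube hh k).prod (measurableSet_gridCube hh k))
      (fun k _ l _ hkl => Set.disjoint_prod.mpr (Or.inl (gridCube_disjoint h hkl)))
      (fun k _ => hgi.integrableOn)]
    refine (setIntegral_le_integral hgi (Filter.Eventually.of_forall fun p => sq_nonneg _)).trans ?_
    rw [← norm_sq_eq_integral, Submodule.coe_norm, WithLp.prod_norm_sq_eq_of_L2]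
    exact le_add_of_nonneg_left (sq_nonneg _)
  have hdpow : d ^ ((n : ℝ) + 2 * s) = √n ^ ((n : ℝ) + 2 * s) * (h ^ n * h ^ (2 * s)) := by
    rw [hd, Real.mul_rpow (by positivity) hh.le, Real.rpow_add hh, Real.rpow_natCast]
  calc ∑ k ∈ S, (2 * h ^ n)⁻¹ * ∫ p in gridCube h k ×ˢ gridCube h k, (u p.1 - u p.2) ^ 2
        ∂((volume : Measure (Space n)).prod volume)
      ≤ ∑ k ∈ S, (2 * h ^ n)⁻¹ * (d ^ ((n : ℝ) + 2 * s) / κ ^ 2 *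
          ∫ p in gridCube h k ×ˢ gridCube h k, g p ^ 2) := by
        gcongr with k hk
        exact hint k hk
    _ = (2 * h ^ n)⁻¹ * (d ^ ((n : ℝ) + 2 * s) / κ ^ 2) *
          ∑ k ∈ S, ∫ p in gridCube h k ×ˢ gridCube h k, g p ^ 2 := by
        rw [Finset.mul_sum]; simp_rw [mul_assoc]
    _ ≤ (2 * h ^ n)⁻¹ * (d ^ ((n : ℝ) + 2 * s) / κ ^ 2) * ‖U‖ ^ 2 := by gcongr
    _ = _ := by
        rw [hdpow, hκ2]
        field_simp

/-- Rellich's theorem for `𝓗₀ˢ(Ω)`, with `Ω` bounded: a norm limit of finite-rank operators. -/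
lemma isCompactOperator_embedding (hn : 1 ≤ n) {s : ℝ} (hs : 0 < s) (hC : 0 < normConst n s)
    {Ω : Set (Space n)} (hΩ : Bornology.IsBounded Ω) : IsCompactOperator (embedding s Ω) := by
  set J := embedding s Ω
  set C := (√n) ^ ((n : ℝ) + 2 * s) / normConst n s with hCd
  have hC0 : 0 ≤ C := by positivity
  choose P hPc hP using fun k : ℕ =>
    exists_compact_approx hn hs hC hΩ (h := 1 / ((k : ℝ) + 1)) (by positivity)
  refine isCompactOperator_of_tendsto (l := Filter.atTop) (F := fun k => P k ∘L J) ?_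
    (Filter.Eventually.of_forall fun k => (hPc k).comp_clm J)
  refine (tendsto_iff_norm_sub_tendsto_zero (E := energySpace s Ω →L[ℝ] L2 n)).mpr ?_
  have hb : ∀ k : ℕ, ‖P k ∘L J - J‖ ≤ √(C * (1 / ((k : ℝ) + 1)) ^ (2 * s)) := by
    intro k
    refine ContinuousLinearMap.opNorm_le_bound _ (Real.sqrt_nonneg _) fun U => ?_
    have h1 := hP k U
    rw [sub_apply, ContinuousLinearMap.comp_apply, norm_sub_rev]
    rw [← Real.sqrt_sq (norm_nonneg U), ← Real.sqrt_mul (by positivity)]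
    exact Real.le_sqrt_of_sq_le h1
  refine squeeze_zero (fun k => (P k ∘L J - J).opNorm_nonneg) hb ?_
  have h1 := (tendsto_one_div_add_atTop_nhds_zero_nat (𝕜 := ℝ)).rpow_const
    (p := 2 * s) (Or.inr (by positivity))
  have h2 := (h1.const_mul C).sqrt
  rwa [Real.zero_rpow (by positivity), mul_zero, Real.sqrt_zero] at h2

/-! ### Potentials and weak solutions -/

/-- Multiplication by functions in `L^∞(ℝⁿ)`, as operators on `L²(ℝⁿ)`. -/
def mulOp (n : ℕ) : Lp ℝ ⊤ (volume : Measure (Space n)) →L[ℝ] L2 n →L[ℝ] L2 n :=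
  (ContinuousLinearMap.mul ℝ ℝ).holderL volume ⊤ 2 2

lemma mulOp_coeFn (f : Lp ℝ ⊤ (volume : Measure (Space n))) (u : L2 n) :
    mulOp n f u =ᵐ[volume] fun x => f x * u x :=
  (ContinuousLinearMap.mul ℝ ℝ).coeFn_holder f u

lemma inner_mulOp {f : Lp ℝ ⊤ (volume : Measure (Space n))} {V : Space n → ℝ}
    (hV : f =ᵐ[volume] V) (u v : L2 n) : ⟪mulOp n f u, v⟫_ℝ = ∫ x, V x * u x * v x := by
  rw [L2.inner_def]
  refine integral_congr_ae ?_
  filter_upwards [mulOp_coeFn f u, hV] with x hx hx'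
  rw [hx, hx', RCLike.inner_apply, conj_trivial, mul_comm]

lemma isSymmetric_mulOp (f : Lp ℝ ⊤ (volume : Measure (Space n))) :
    (mulOp n f : L2 n →ₗ[ℝ] L2 n).IsSymmetric := by
  intro u v
  simp only [ContinuousLinearMap.coe_coe]
  rw [real_inner_comm (mulOp n f v), inner_mulOp (Filter.EventuallyEq.refl _ _),
    inner_mulOp (Filter.EventuallyEq.refl _ _)]
  congr 1; ext x; ring

lemma memLp_top_bcf (b : BoundedContinuousFunction (Space n) ℝ) :
    MemLp b ⊤ (volume : Measure (Space n)) :=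
  memLp_top_of_bound b.continuous.aestronglyMeasurable ‖b‖
    (Filter.Eventually.of_forall b.norm_coe_le_norm)

/-- The class in `L^∞(ℝⁿ)` of a bounded continuous function. -/
def bcfToLpTop (n : ℕ) :
    BoundedContinuousFunction (Space n) ℝ →L[ℝ] Lp ℝ ⊤ (volume : Measure (Space n)) :=
  LinearMap.mkContinuous
    { toFun := fun b => (memLp_top_bcf b).toLp b
      map_add' := fun a b => MemLp.toLp_add (memLp_top_bcf a) (memLp_top_bcf b)
      map_smul' := fun c b => MemLp.toLp_const_smul c (memLp_top_bcf b) } 1 (fun b => by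
    change ‖(memLp_top_bcf b).toLp b‖ ≤ 1 * ‖b‖
    rw [one_mul, Lp.norm_toLp, eLpNorm_exponent_top]
    refine ENNReal.toReal_le_of_le_ofReal (norm_nonneg _) (eLpNormEssSup_le_of_ae_bound ?_)
    exact Filter.Eventually.of_forall b.norm_coe_le_norm)

lemma bcfToLpTop_coeFn (b : BoundedContinuousFunction (Space n) ℝ) :
    bcfToLpTop n b =ᵐ[volume] b := (memLp_top_bcf b).coeFn_toLp

/-- Testing against all bounded continuous `b` gives `φ ψ = 0` and `φ² = ψ²` almost everywhere. -/
lemma eq_zero_of_forall_bcf {φ ψ : L2 n}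
    (h1 : ∀ b, ⟪mulOp n (bcfToLpTop n b) φ, ψ⟫_ℝ = 0)
    (h2 : ∀ b, ⟪mulOp n (bcfToLpTop n b) φ, φ⟫_ℝ = ⟪mulOp n (bcfToLpTop n b) ψ, ψ⟫_ℝ) :
    φ = 0 := by
  have key : ∀ g : Space n → ℝ, Continuous g → HasCompactSupport g →
      ∃ b : BoundedContinuousFunction (Space n) ℝ, ⇑b = g := by
    intro g hg hs
    obtain ⟨C, hC⟩ := hs.exists_bound_of_continuous hg
    exact ⟨BoundedContinuousFunction.ofNormedAddCommGroup g hg C hC, rfl⟩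
  have i1 : Integrable (fun x => φ x * ψ x) := (Lp.memLp φ).integrable_mul (Lp.memLp ψ)
  have i2 : Integrable (fun x => φ x * φ x) := (Lp.memLp φ).integrable_mul (Lp.memLp φ)
  have i3 : Integrable (fun x => ψ x * ψ x) := (Lp.memLp ψ).integrable_mul (Lp.memLp ψ)
  have e1 : ∀ᵐ x, φ x * ψ x = 0 := by
    refine ae_eq_zero_of_integral_contDiff_smul_eq_zero i1.locallyIntegrable fun g hg hs => ?_
    obtain ⟨b, rfl⟩ := key g hg.continuous hs
    have := h1 b
    rw [inner_mulOp (bcfToLpTop_coeFn b)] at this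
    simpa [mul_assoc] using this
  have e2 : ∀ᵐ x, φ x * φ x = ψ x * ψ x := by
    refine ae_eq_of_integral_contDiff_smul_eq i2.locallyIntegrable i3.locallyIntegrable
      fun g hg hs => ?_
    obtain ⟨b, rfl⟩ := key g hg.continuous hs
    have := h2 b
    rw [inner_mulOp (bcfToLpTop_coeFn b), inner_mulOp (bcfToLpTop_coeFn b)] at this
    simpa [mul_assoc] using this
  rw [Lp.eq_zero_iff_ae_eq_zero]
  filter_upwards [e1, e2] with x h1 h2
  rcases mul_eq_zero.mp h1 with h | h
  · exact h
  · rw [h, mul_zero] at h2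
    exact mul_self_eq_zero.mp h2

/-- The weak eigenvalue equation in `𝓗₀ˢ(Ω)` is the operator equation of `formEigenspace`. The
eigenvalue is shifted by one because the inner product of `energySpace` contains `⟨u, v⟩`. The
operator `B` needs to be multiplication by `V` on functions that vanish outside `Ω` only. -/
lemma isWeakSolution_iff {s : ℝ} (hC : 0 < normConst n s) {Ω : Set (Space n)}
    {V : Space n → ℝ} {B : L2 n →L[ℝ] L2 n}
    (hB : ∀ u ∈ Hs0 s Ω, ∀ v, ⟪B u, v⟫_ℝ = ∫ x, V x * u x * v x) (lam : ℝ) (φ : L2 n) :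
    IsWeakSolution s Ω V lam φ ↔ φ ∈ formEigenspace (embedding s Ω) B (lam + 1) := by
  set J := embedding s Ω with hJ
  have hin : ∀ u v : L2 n, ⟪u, v⟫_ℝ = ∫ x, u x * v x := by
    intro u v
    rw [L2.inner_def]
    refine integral_congr_ae (Filter.Eventually.of_forall fun x => ?_)
    simp only [RCLike.inner_apply, conj_trivial, mul_comm]
  have hform : ∀ U W : energySpace s Ω, ⟪U + J.adjoint (B (J U) - (lam + 1) • J U), W⟫_ℝ =
      energy s (J U) (J W) + ⟪B (J U), J W⟫_ℝ - lam * ⟪J U, J W⟫_ℝ := by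
    intro U W
    rw [inner_add_left, ContinuousLinearMap.adjoint_inner_left, inner_sub_left,
      real_inner_smul_left, inner_energySpace hC.le]
    ring
  have hweak : ∀ U W : energySpace s Ω,
      (energy s (J U) (J W) + ∫ x, V x * J U x * J W x = lam * ∫ x, J U x * J W x) ↔
        ⟪U + J.adjoint (B (J U) - (lam + 1) • J U), W⟫_ℝ = 0 := by
    intro U W
    rw [hform, hB _ (embedding_mem hC U), ← hin, sub_eq_zero]
  rw [mem_formEigenspace]
  constructor
  · rintro ⟨hφ, h⟩
    obtain ⟨U, rfl⟩ := exists_embedding_eq hφ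
    have h0 : U + J.adjoint (B (J U) - (lam + 1) • J U) = 0 :=
      ext_inner_right ℝ fun W => by
        rw [inner_zero_left]
        exact (hweak U W).mp (h (J W) (embedding_mem hC W))
    have := congrArg J h0
    rwa [map_add, map_zero] at this
  · intro h
    obtain ⟨U, hU⟩ : ∃ U, U = -J.adjoint (B φ - (lam + 1) • φ) := ⟨_, rfl⟩
    have hJU : J U = φ := by
      rw [hU, map_neg]; exact (eq_neg_of_add_eq_zero_left h).symm
    refine ⟨hJU ▸ embedding_mem hC U, fun v hv => ?_⟩
    obtain ⟨W, rfl⟩ := exists_embedding_eq hv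
    have h0 : U + J.adjoint (B (J U) - (lam + 1) • J U) = 0 := by
      rw [hJU, hU, neg_add_cancel]
    have := (hweak U W).mpr (by rw [h0, inner_zero_left])
    rwa [hJU] at this

/-- A continuous function may be unbounded on `ℝⁿ`, but its restriction to the bounded set `Ω` is in
`L^∞`. -/
lemma exists_lpTop_eq_on {Ω : Set (Space n)} (hΩ : IsOpen Ω) (hb : Bornology.IsBounded Ω)
    {a : Space n → ℝ} (ha : Continuous a) :
    ∃ f : Lp ℝ ⊤ (volume : Measure (Space n)), f =ᵐ[volume] Ω.indicator a := by
  obtain ⟨C, hC⟩ := hb.isCompact_closure.exists_bound_of_continuousOn ha.continuousOn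
  have : MemLp (Ω.indicator a) ⊤ (volume : Measure (Space n)) := by
    refine memLp_top_of_bound (ha.aestronglyMeasurable.indicator hΩ.measurableSet) (max C 0)
      (Filter.Eventually.of_forall fun x => ?_)
    by_cases hx : x ∈ Ω
    · rw [indicator_of_mem hx]
      exact (hC x (subset_closure hx)).trans (le_max_left _ _)
    · rw [indicator_of_notMem hx, norm_zero]
      exact le_max_right _ _
  exact ⟨this.toLp _, this.coeFn_toLp⟩

/-- Every continuous potential becomes one with simple Dirichlet eigenvalues after adding a suitable
bounded continuous function of arbitrarily small norm. -/
theorem exists_small_potential_simple (hn : 1 ≤ n) {s : ℝ} (hs0 : 0 < s) (hs1 : s < 1)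
    {Ω : Set (Space n)} (hΩ : IsOpen Ω) (hb : Bornology.IsBounded Ω) {a : Space n → ℝ}
    (ha : Continuous a) {ε : ℝ} (hε : 0 < ε) :
    ∃ b : BoundedContinuousFunction (Space n) ℝ, ‖b‖ < ε ∧
      ∀ lam : ℝ, IsEigenvalue s Ω (fun x => a x + b x) lam →
        IsSimpleEigenvalue s Ω (fun x => a x + b x) lam := by
  have hC := normConst_pos hn hs0 hs1
  obtain ⟨f, hf⟩ := exists_lpTop_eq_on hΩ hb ha
  have hdense := dense_setOf_simple_eigenspaces (isCompactOperator_embedding hn hs0 hC hb)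
    (isSymmetric_mulOp f)
    (mulOp n ∘L bcfToLpTop n) (fun b => isSymmetric_mulOp _)
    (fun φ ψ h1 h2 => eq_zero_of_forall_bcf h1 h2)
  obtain ⟨b, hbε, hb⟩ := hdense.exists_mem_open Metric.isOpen_ball
    ⟨(0 : BoundedContinuousFunction (Space n) ℝ), Metric.mem_ball_self hε⟩ |>.imp
    fun b h => And.intro h.2 h.1
  refine ⟨b, mem_ball_zero_iff.mp hbε, fun lam => ?_⟩
  have hB : ∀ u ∈ Hs0 s Ω, ∀ v : L2 n,
      ⟪(mulOp n f + (mulOp n ∘L bcfToLpTop n) b) u, v⟫_ℝ = ∫ x, (a x + b x) * u x * v x := by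
    intro u hu v
    rw [ContinuousLinearMap.comp_apply, ← map_add]
    have h1 : (f + bcfToLpTop n b : Lp ℝ ⊤ (volume : Measure (Space n))) =ᵐ[volume]
        fun x => Ω.indicator a x + b x := by
      filter_upwards [Lp.coeFn_add f (bcfToLpTop n b), hf, bcfToLpTop_coeFn b] with x h1 h2 h3
      rw [h1, Pi.add_apply, h2, h3]
    rw [inner_mulOp h1]
    refine integral_congr_ae ?_
    filter_upwards [hu.2] with x hx
    by_cases hxΩ : x ∈ Ω
    · rw [indicator_of_mem hxΩ]
    · rw [hx hxΩ]; simp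
  have hiff := isWeakSolution_iff hC hB lam
  rintro ⟨φ, hφ0, hφ⟩
  refine ⟨φ, hφ0, fun ψ => ?_⟩
  rw [hiff] at hφ ⊢
  constructor
  · intro hψ
    -- The component of `ψ` orthogonal to `φ` is again in the eigenspace, hence zero.
    set c := ⟪φ, ψ⟫_ℝ / ⟪φ, φ⟫_ℝ
    have hφφ : ⟪φ, φ⟫_ℝ ≠ 0 := inner_self_ne_zero.mpr hφ0
    have := hb _ φ hφ (ψ - c • φ) (Submodule.sub_mem _ hψ (Submodule.smul_mem _ _ hφ)) (by
      rw [inner_sub_right, real_inner_smul_right, div_mul_cancel₀ _ hφφ, sub_self])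
    exact ⟨c, sub_eq_zero.mp (this.resolve_left hφ0)⟩
  · rintro ⟨c, rfl⟩
    exact Submodule.smul_mem _ _ hφ

end FracLaplacian

end

theorem theorem3 (n : ℕ) (hn : 1 ≤ n) (s : ℝ) (hs0 : 0 < s) (hs1 : s < 1)
    (Ω : Set (FracLaplacian.Space n)) (hΩ : FracLaplacian.IsBoundedC11 Ω) :
    ∃ δ : ℝ, 0 < δ ∧
      ∀ a : FracLaplacian.Space n → ℝ, Continuous a →
        ((∀ x ∈ closure Ω, 0 < a x) ∨ (∀ x ∈ Ω, |a x| ≤ δ)) →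
        ∀ ε : ℝ, 0 < ε →
          ∃ b : BoundedContinuousFunction (FracLaplacian.Space n) ℝ, ‖b‖ < ε ∧
            ∀ lam : ℝ, FracLaplacian.IsEigenvalue s Ω (fun x => a x + b x) lam →
              FracLaplacian.IsSimpleEigenvalue s Ω (fun x => a x + b x) lam := by
  -- Any `δ` serves: the shift by `‖B‖` in the resolvent makes the size and sign of `a` immaterial.
  exact ⟨1, one_pos, fun a ha _ ε hε =>
    FracLaplacian.exists_small_potential_simple hn hs0 hs1 hΩ.isOpen hΩ.isBounded ha hε⟩
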